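/- Let $G=(V,E)$ be a finite connected graph with $m=|E|$ edges, each edge $e$ having a length $\ell(e)>0$, and let $(|G|,d_G)$ be the associated metric graph, where $d_G$ is the shortest path metric. For a basepoint $p\in|G|$ let $\mathrm{Dg}(p)$ be the $0$-dimensional persistence diagram of the function $d_G(p,\cdot):|G|\to\mathbb{R}$ filtered by its superlevel sets $\{x : d_G(p,x)\ge\alpha\}$ with $\alpha$ decreasing. Its points $(\beta,\delta)$, $\delta<\beta$, record a connected component that is born at $\beta$ and merges with an older one at $\delta$ (the component that never merges gives a point with $\delta=-\infty$). Let the basepoint move along an edge of $G$ of length $L$, with arclength parametrization $p:[0,L]\to|G|$. Let $[a,c]\subseteq[0,L]$ (in particular $a=0$, $c=L$ is allowed), and let $(\beta(s),\delta(s))$, $s\in[a,c]$, track a persistence point: $\beta$ and $\delta$ are continuous on $[a,c]$, $(\beta(s),\delta(s))\in\mathrm{Dg}(p(s))$ for all $s\in(a,c)$, and at each of $s=a$ and $s=c$ either $(\beta(s),\delta(s))\in\mathrm{Dg}(p(s))$ or $\beta(s)=\delta(s)$ (tracked points may appear and disappear on the diagonal). Then the birth-time function $\beta:[a,c]\to\mathbb{R}$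 is continuous and piecewise linear with at most $C\,m$ pieces, where $C$ is an absolute constant, and each linear piece has slope $1$, $-1$ or $0$. In particular $\beta$ is $1$-Lipschitz on $[a,c]$. -/

import Mathlib

open Set Filter Topology

noncomputable section

namespace MetricGraph

/-- The point of the geometric realization (in barycentric coordinates) that represents
the graph node `v`. -/
def node {V : Type*} (v : V) : V → ℝ := Set.indicator {v} 1

/-- Arclength parametrization of the edge `uv` of length `ℓ s(u, v)`: the point at distance `t`
from `u` along the edge, for `0 ≤ t ≤ ℓ s(u, v)`. -/
def edgePoint {V : Type*} (ℓ : Sym2 V → ℝ) (u v : V) (t : ℝ) : V → ℝ :=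
  (1 - t / ℓ s(u, v)) • node u + (t / ℓ s(u, v)) • node v

/-- The geometric realization `|G|`: all nodes, together with the straight segments that join
adjacent nodes. It carries the subspace topology of `V → ℝ`. -/
def realization {V : Type*} (G : SimpleGraph V) : Set (V → ℝ) :=
  Set.range node ∪ {x | ∃ u v, G.Adj u v ∧ x ∈ segment ℝ (node u) (node v)}

/-- `PathLength G ℓ x y r`: some path from `x` to `y` in `|G|` has length `r`. A path is a finite
sequence of moves, each inside a single edge; the length of a move is measured by
the arclength parametrization of that edge. -/
inductive PathLength {V : Type*} (G : SimpleGraph V) (ℓ : Sym2 V → ℝ) :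
    (V → ℝ) → (V → ℝ) → ℝ → Prop
  | refl (x : V → ℝ) : PathLength G ℓ x x 0
  | move (u v : V) (t t' : ℝ) (y : V → ℝ) (r : ℝ) (huv : G.Adj u v)
      (ht : t ∈ Set.Icc 0 (ℓ s(u, v))) (ht' : t' ∈ Set.Icc 0 (ℓ s(u, v)))
      (h : PathLength G ℓ (edgePoint ℓ u v t') y r) :
      PathLength G ℓ (edgePoint ℓ u v t) y (|t' - t| + r)

/-- The shortest path metric `d_G`. -/
def geodist {V : Type*} (G : SimpleGraph V) (ℓ : Sym2 V → ℝ) (x y : V → ℝ) : ℝ :=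
  sInf {r | PathLength G ℓ x y r}

/-- The number of connected components of the superlevel set `{f ≥ β}` of `f` on `X` that contain
a point of `{f ≥ α}`. For `β ≤ α` this is the rank of the map from `H₀({f ≥ α})`
to `H₀({f ≥ β})` induced by the inclusion. -/
def persistentRank {E : Type*} [TopologicalSpace E] (X : Set E) (f : E → ℝ) (α β : ℝ) : ℕ :=
  Set.ncard {K : Set E | ∃ x ∈ X, α ≤ f x ∧ K = connectedComponentIn {y ∈ X | β ≤ f y} x}

/-- `IsPersistencePoint X f b d`: the point `(b, d)` belongs to the 0-dimensional persistence
diagram of the superlevel set filtration of `f` on `X`. For real `d < b` this says that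
the number of classes that are born at a time in `[b - ε, b + ε)` and die at
a time in `[d - ε, d + ε)`, counted by inclusion-exclusion from the persistent ranks,
is positive for all small `ε > 0`. The death time `⊥` is for classes that never die. -/
def IsPersistencePoint {E : Type*} [TopologicalSpace E] (X : Set E) (f : E → ℝ)
    (b : ℝ) (d : EReal) : Prop :=
  (∃ d' : ℝ, d = (d' : EReal) ∧ d' < b ∧ ∀ᶠ ε in 𝓝[>] (0 : ℝ),
      0 < ((persistentRank X f (b - ε) (d' + ε) : ℤ) - persistentRank X f (b + ε) (d' + ε))
        - ((persistentRank X f (b - ε) (d' - ε) : ℤ) - persistentRank X f (b + ε) (d' - ε))) ∨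
  (d = ⊥ ∧ ∀ᶠ ε in 𝓝[>] (0 : ℝ), ∀ᶠ β in atBot,
      persistentRank X f (b + ε) β < persistentRank X f (b - ε) β)

/-- `InDiagram G ℓ p b d`: `(b, d)` is a point of the 0-dimensional persistence diagram of
the distance function `d_G(p, ·)` to the basepoint `p` on `|G|`. -/
def InDiagram {V : Type*} (G : SimpleGraph V) (ℓ : Sym2 V → ℝ) (p : V → ℝ)
    (b : ℝ) (d : EReal) : Prop :=
  IsPersistencePoint (realization G) (geodist G ℓ p) b d

/-- `IsTracking G ℓ u v a c b d`: while the basepoint runs through the part `[a, c]` of the edge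
`uv`, the functions `b` and `d` track one persistence point: `(b s, d s)` moves continuously
and is a point of the diagram at the parameter `s`, except that at the ends of `[a, c]` it may lie
on the diagonal (where tracked points appear and disappear). -/
structure IsTracking {V : Type*} (G : SimpleGraph V) (ℓ : Sym2 V → ℝ) (u v : V)
    (a c : ℝ) (b : ℝ → ℝ) (d : ℝ → EReal) : Prop where
  continuousOn_birth : ContinuousOn b (Set.Icc a c)
  continuousOn_death : ContinuousOn d (Set.Icc a c)
  mem_interior : ∀ s ∈ Set.Ioo a c, InDiagram G ℓ (edgePoint ℓ u v s) (b s) (d s)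
  mem_left : InDiagram G ℓ (edgePoint ℓ u v a) (b a) (d a) ∨ d a = (b a : EReal)
  mem_right : InDiagram G ℓ (edgePoint ℓ u v c) (b c) (d c) ∨ d c = (b c : EReal)

/-- On `[a, c]` the function `g` is continuous and piecewise linear with at most `N` pieces,
each of slope `1`, `-1` or `0`. -/
def IsUnitPiecewiseLinearOn (g : ℝ → ℝ) (a c : ℝ) (N : ℕ) : Prop :=
  ∃ k : ℕ, k ≤ N ∧ ∃ x : ℕ → ℝ, Monotone x ∧ x 0 = a ∧ x k = c ∧
    ∀ i < k, ∃ σ : ℝ, (σ = 1 ∨ σ = -1 ∨ σ = 0) ∧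
      ∀ s ∈ Set.Icc (x i) (x (i + 1)), g s = g (x i) + σ * (s - x i)

end MetricGraph

end

namespace MetricGraph

/-! ### Continuous functions whose graph lies on finitely many lines of slope `1`, `-1`, `0` -/

/-! A birth time must be the height of a peak. From any point of `|G|` one can climb along its edge,
inside the superlevel set of that point, to a peak of the distance function. Superlevel components
therefore appear only at peak heights (`IsPersistencePoint.birth_mem`).

Let the basepoint be at arclength `s` on `uv`. The distance to each node is the minimum of a route
through `u` (slope `1` in `s`) and a route through `v` (slope `-1`). A peak on another edge `wz` has
height half of the two node distances plus the edge length. So it lies on a line of slope `1` if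
both routes use `u`, of slope `-1` if both use `v`, and of slope `0` otherwise. The edge `uv` itself
adds one line of each kind. Hence the graph of `b` lies on at most `m + 1` lines of slope `1`, at
most `m + 1` of slope `-1`, and finitely many horizontal lines.

Continuity makes `b` follow a single line just to the right of each point, so it is `1`-Lipschitz. A
`1`-Lipschitz function that leaves a line of slope `±1` never meets it again, so each sloped line is
used once. The horizontal lines need not be counted, since two flat pieces are separated by a sloped
one. This gives a bound linear in `m` (`isUnitPiecewiseLinearOn_of_mem_lines`). -/

theorem IsUnitPiecewiseLinearOn.refl (g : ℝ → ℝ) (a : ℝ) : IsUnitPiecewiseLinearOn g a a 0 :=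
  ⟨0, le_rfl, fun _ => a, monotone_const, rfl, rfl, by simp⟩

theorem IsUnitPiecewiseLinearOn.mono {g : ℝ → ℝ} {a c : ℝ} {N M : ℕ}
    (h : IsUnitPiecewiseLinearOn g a c N) (hNM : N ≤ M) : IsUnitPiecewiseLinearOn g a c M := by
  obtain ⟨k, hk, hx⟩ := h
  exact ⟨k, hk.trans hNM, hx⟩

theorem IsUnitPiecewiseLinearOn.cons {g : ℝ → ℝ} {a q c σ : ℝ} {N : ℕ} (haq : a ≤ q)
    (hσ : σ = 1 ∨ σ = -1 ∨ σ = 0) (hl : ∀ s ∈ Icc a q, g s = g a + σ * (s - a))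
    (h : IsUnitPiecewiseLinearOn g q c N) : IsUnitPiecewiseLinearOn g a c (N + 1) := by
  obtain ⟨k, hk, x, hx, rfl, h1, hp⟩ := h
  refine ⟨k + 1, by omega, fun i => Nat.casesOn i a x, monotone_nat_of_le_succ ?_, rfl, h1, ?_⟩
  · rintro (_ | i)
    · exact haq
    · exact hx (Nat.le_succ i)
  · rintro (_ | i) hi
    · exact ⟨σ, hσ, hl⟩
    · exact hp i (by omega)

theorem eventually_eq_of_mem_finite {α : Type*} {l : Filter α} {φ : α → ℝ} {z : ℝ} {S : Set ℝ}
    (hS : S.Finite) (hφ : Tendsto φ l (𝓝 z)) : ∀ᶠ y in l, φ y ∈ S → φ y = z := by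
  have : (S \ {z})ᶜ ∈ 𝓝 z := (hS.subset sdiff_subset).isClosed.isOpen_compl.mem_nhds (by simp)
  filter_upwards [hφ this] with y hy hyS
  by_contra hne
  exact hy ⟨hyS, hne⟩

section Lines

variable {b : ℝ → ℝ} {a c : ℝ} {A B C : Set ℝ}

/-- Near `x`, finiteness and continuity leave only the lines through `(x, b x)`. The difference
quotient at `x` is then continuous with values in the discrete set `{1, -1, 0}`, hence constant on
an interval to the right of `x`. The memberships in `A` and `B` record which line is in use, so that
it can later be discarded. -/
theorem exists_slope_right (hA : A.Finite) (hB : B.Finite) (hC : C.Finite)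
    (hb : ContinuousOn b (Icc a c))
    (hmem : ∀ s ∈ Ioo a c, b s - s ∈ A ∨ b s + s ∈ B ∨ b s ∈ C) {x : ℝ} (hx : x ∈ Ico a c) :
    ∃ σ : ℝ, ((σ = 1 ∧ b x - x ∈ A) ∨ (σ = -1 ∧ b x + x ∈ B) ∨ σ = 0) ∧
      ∀ᶠ y in 𝓝[>] x, b y = b x + σ * (y - x) := by
  have hsub : Ioo x c ⊆ Icc a c := fun y hy => ⟨hx.1.trans hy.1.le, hy.2.le⟩
  have hbx : Tendsto b (𝓝[>] x) (𝓝 (b x)) := by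
    rw [← nhdsWithin_Ioo_eq_nhdsGT hx.2]
    exact (hb x ⟨hx.1, hx.2.le⟩).mono hsub
  have hid : Tendsto (fun y : ℝ => y) (𝓝[>] x) (𝓝 x) := nhdsWithin_le_nhds
  have hev : ∀ᶠ y in 𝓝[>] x, y ∈ Ioo x c ∧ ((b y = b x + (y - x) ∧ b x - x ∈ A) ∨
      (b y = b x - (y - x) ∧ b x + x ∈ B) ∨ b y = b x) := by
    filter_upwards [eventually_eq_of_mem_finite hA (hbx.sub hid),
      eventually_eq_of_mem_finite hB (hbx.add hid), eventually_eq_of_mem_finite hC hbx,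
      Ioo_mem_nhdsGT hx.2] with y h1 h2 h3 hy
    refine ⟨hy, ?_⟩
    rcases hmem y ⟨hx.1.trans_lt hy.1, hy.2⟩ with h | h | h
    · have := h1 h
      exact Or.inl ⟨by linarith, this ▸ h⟩
    · have := h2 h
      exact Or.inr (Or.inl ⟨by linarith, this ▸ h⟩)
    · exact Or.inr (Or.inr (h3 h))
  obtain ⟨u, hu, hsu⟩ := mem_nhdsGT_iff_exists_Ioo_subset.1 hev
  have hu : x < u := hu
  have hcont : ContinuousOn (fun y => (b y - b x) / (y - x)) (Ioo x u) := by
    refine ContinuousOn.div ?_ (by fun_prop) fun y hy => (sub_pos.2 hy.1).ne'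
    exact (hb.mono fun y hy => hsub (hsu hy).1).sub continuousOn_const
  have hfin : ({1, -1, 0} : Set ℝ).Finite := by simp
  have hdisc : IsDiscrete ({1, -1, 0} : Set ℝ) := hfin.isDiscrete
  have hmaps : MapsTo (fun y => (b y - b x) / (y - x)) (Ioo x u) {1, -1, 0} := by
    intro y hy
    have hne : y - x ≠ 0 := (sub_pos.2 hy.1).ne'
    rcases (hsu hy).2 with h | h | h
    · left
      simp [h.1, hne]
    · right; left
      simp only [h.1]
      field_simp
      ring
    · right; right
      simp [h]
  have hmid : (x + u) / 2 ∈ Ioo x u := ⟨by linarith, by linarith⟩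
  refine ⟨(b ((x + u) / 2) - b x) / ((x + u) / 2 - x), ?_, ?_⟩
  · have hne : (x + u) / 2 - x ≠ 0 := (sub_pos.2 hmid.1).ne'
    rcases (hsu hmid).2 with h | h | h
    · exact Or.inl ⟨by rw [h.1, add_sub_cancel_left, div_self hne], h.2⟩
    · exact Or.inr (Or.inl
        ⟨by rw [h.1, sub_sub_cancel_left, neg_div, div_self hne], h.2⟩)
    · exact Or.inr (Or.inr (by rw [h]; simp))
  · filter_upwards [Ioo_mem_nhdsGT hu] with y hy
    have hne : y - x ≠ 0 := (sub_pos.2 hy.1).ne'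
    have := isPreconnected_Ioo.constant_of_mapsTo hdisc hcont hmaps hmid hy
    rw [this, div_mul_cancel₀ _ hne, add_sub_cancel]

/-- The right derivative exists at every point of `[a, c)` and has absolute value at most `1`, so
the one-sided mean value inequality applies. -/
theorem lipschitzOnWith_of_mem_lines (hA : A.Finite) (hB : B.Finite) (hC : C.Finite)
    (hb : ContinuousOn b (Icc a c))
    (hmem : ∀ s ∈ Ioo a c, b s - s ∈ A ∨ b s + s ∈ B ∨ b s ∈ C) :
    LipschitzOnWith 1 b (Icc a c) := by
  have key : ∀ s ∈ Icc a c, ∀ t ∈ Icc a c, s ≤ t → ‖b t - b s‖ ≤ 1 * (t - s) := by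
    intro s hs t ht hst
    have hex : ∀ x, ∃ σ : ℝ, x ∈ Ico s t → ‖σ‖ ≤ 1 ∧ HasDerivWithinAt b σ (Ici x) x := by
      intro x
      by_cases hx : x ∈ Ico s t
      · obtain ⟨σ, hσ, hev⟩ := exists_slope_right hA hB hC hb hmem
          (x := x) ⟨hs.1.trans hx.1, hx.2.trans_le ht.2⟩
        refine ⟨σ, fun _ => ⟨?_, ?_⟩⟩
        · rcases hσ with h | h | h
          · simp [h.1]
          · simp [h.1]
          · simp [h]
        · rw [← hasDerivWithinAt_Ioi_iff_Ici]
          have hline : HasDerivWithinAt (fun y => b x + σ * (y - x)) (σ * 1) (Ioi x) x :=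
            ((((hasDerivAt_id x).sub_const x).const_mul σ).const_add (b x)).hasDerivWithinAt
          rw [mul_one] at hline
          exact hline.congr_of_eventuallyEq hev (by simp)
      · exact ⟨0, fun h => (hx h).elim⟩
    choose σ hσ using hex
    exact norm_image_sub_le_of_norm_deriv_right_le_segment (f' := σ)
      (hb.mono (Icc_subset_Icc hs.1 ht.2)) (fun x hx => (hσ x hx).2)
      (fun x hx => (hσ x hx).1) t ⟨hst, le_rfl⟩
  refine LipschitzOnWith.of_dist_le_mul fun s hs t ht => ?_
  rw [NNReal.coe_one, Real.dist_eq, Real.dist_eq]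
  rcases le_total s t with h | h
  · have := key s hs t ht h
    rw [Real.norm_eq_abs, abs_sub_comm] at this
    rwa [abs_sub_comm s t, abs_of_nonneg (sub_nonneg.2 h)]
  · have := key t ht s hs h
    rw [Real.norm_eq_abs] at this
    rwa [abs_of_nonneg (sub_nonneg.2 h)]

/-- The supremum of the linear stretches is attained by continuity. The stretch may be degenerate
(`q = a`). -/
theorem exists_maximal_linear_stretch (hb : ContinuousOn b (Icc a c)) (hac : a ≤ c) (σ : ℝ) :
    ∃ q ∈ Icc a c, (∀ z ∈ Icc a q, b z = b a + σ * (z - a)) ∧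
      (q < c → ¬ ∀ᶠ y in 𝓝[>] q, b y = b q + σ * (y - q)) := by
  set T : Set ℝ := {y | y ∈ Icc a c ∧ ∀ z ∈ Icc a y, b z = b a + σ * (z - a)} with hT
  have haT : a ∈ T := ⟨⟨le_rfl, hac⟩, fun z hz => by
    obtain rfl : z = a := le_antisymm hz.2 hz.1
    simp⟩
  have hbdd : BddAbove T := ⟨c, fun y hy => hy.1.2⟩
  have haq : a ≤ sSup T := le_csSup hbdd haT
  have hqc : sSup T ≤ c := csSup_le ⟨a, haT⟩ fun y hy => hy.1.2
  have hlt : ∀ z ∈ Ico a (sSup T), b z = b a + σ * (z - a) := by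
    intro z hz
    obtain ⟨y, hy, hzy⟩ := exists_lt_of_lt_csSup ⟨a, haT⟩ hz.2
    exact hy.2 z ⟨hz.1, hzy.le⟩
  have hle : ∀ z ∈ Icc a (sSup T), b z = b a + σ * (z - a) := by
    rcases haq.eq_or_lt with h | h
    · rw [← h]
      exact haT.2
    · have : EqOn b (fun z => b a + σ * (z - a)) (closure (Ico a (sSup T)) ∩ Icc a (sSup T)) := by
        rw [closure_Ico h.ne, inter_self]
        exact EqOn.of_subset_closure hlt (hb.mono (Icc_subset_Icc_right hqc)) (by fun_prop)
          Ico_subset_Icc_self (closure_Ico h.ne).ge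
      rwa [closure_Ico h.ne, inter_self] at this
  refine ⟨sSup T, ⟨haq, hqc⟩, hle, fun hq hev => ?_⟩
  obtain ⟨u, hu, hsu⟩ := mem_nhdsGT_iff_exists_Ioo_subset.1
    (hev.and (Ioo_mem_nhdsGT hq))
  have hu : sSup T < u := hu
  have hmid : (sSup T + u) / 2 ∈ Ioo (sSup T) u := ⟨by linarith, by linarith⟩
  have hin : (sSup T + u) / 2 ∈ T := by
    refine ⟨⟨haq.trans hmid.1.le, (hsu hmid).2.2.le⟩, fun z hz => ?_⟩
    rcases le_or_gt z (sSup T) with h | h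
    · exact hle z ⟨hz.1, h⟩
    · rw [(hsu ⟨h, hz.2.trans_lt hmid.2⟩).1, hle _ ⟨haq, le_rfl⟩]
      ring
  exact absurd (le_csSup hbdd hin) (not_le.2 hmid.1)

/-- Induction on the number of sloped lines: a flat stretch and a sloped stretch use up one line,
and a last flat stretch accounts for the `+ 1`. The set `C` stays fixed because horizontal lines are
never discarded. -/
theorem isUnitPiecewiseLinearOn_of_mem_lines (n : ℕ) : ∀ {a c : ℝ} {A B : Set ℝ}, A.Finite →
    B.Finite → C.Finite → a ≤ c → ContinuousOn b (Icc a c) →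
    (∀ s ∈ Ioo a c, b s - s ∈ A ∨ b s + s ∈ B ∨ b s ∈ C) → A.ncard + B.ncard ≤ n →
    IsUnitPiecewiseLinearOn b a c (2 * n + 1) := by
  induction n using Nat.strong_induction_on with
  | _ n ih =>
  intro a c A B hA hB hC hac hb hmem hn
  have hlip := lipschitzOnWith_of_mem_lines hA hB hC hb hmem
  have hdist : ∀ s ∈ Icc a c, ∀ t ∈ Icc a c, s ≤ t → |b s - b t| ≤ t - s := by
    intro s hs t ht hst
    have := hlip.dist_le_mul s hs t ht
    rwa [NNReal.coe_one, one_mul, Real.dist_eq, Real.dist_eq, abs_sub_comm s t,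
      abs_of_nonneg (sub_nonneg.2 hst)] at this
  obtain ⟨q, hq, hlin, hmax⟩ := exists_maximal_linear_stretch hb hac 0
  rcases hq.2.eq_or_lt with rfl | hqc
  · exact ((IsUnitPiecewiseLinearOn.refl b q).cons hq.1 (by simp) hlin).mono (by omega)
  have hbq : ContinuousOn b (Icc q c) := hb.mono (Icc_subset_Icc_left hq.1)
  obtain ⟨σ, hσ, hev⟩ := exists_slope_right hA hB hC hb hmem (x := q) ⟨hq.1, hqc⟩
  obtain ⟨r, hr, hlin', hmax'⟩ := exists_maximal_linear_stretch hbq hqc.le σ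
  have har : a ≤ r := hq.1.trans hr.1
  have hmem' : ∀ s ∈ Ioo r c, b s - s ∈ A ∨ b s + s ∈ B ∨ b s ∈ C :=
    fun s hs => hmem s ⟨har.trans_lt hs.1, hs.2⟩
  have hbr : ContinuousOn b (Icc r c) := hb.mono (Icc_subset_Icc_left har)
  have hbr_eq := hlin' r ⟨hr.1, le_rfl⟩
  -- Meeting the line again at `s > r` would leave no slack in the Lipschitz bound, so `b` would
  -- follow the line on all of `[r, s]`, against the maximality of `r`.
  have hoff : σ * σ = 1 → ∀ s ∈ Ioo r c, b s ≠ b q + σ * (s - q) := by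
    intro hσσ s hs heq
    refine hmax' (hs.1.trans hs.2) ?_
    filter_upwards [Ioo_mem_nhdsGT hs.1] with y hy
    have hrm : r ∈ Icc a c := ⟨har, hr.2⟩
    have hsm : s ∈ Icc a c := ⟨har.trans hs.1.le, hs.2.le⟩
    have hym : y ∈ Icc a c := ⟨har.trans hy.1.le, hy.2.le.trans hs.2.le⟩
    have h1 := abs_le.1 (hdist r hrm y hym hy.1.le)
    have h2 := abs_le.1 (hdist y hym s hsm hy.2.le)
    rcases mul_self_eq_one_iff.1 hσσ with rfl | rfl <;> linarith [h1.1, h1.2, h2.1, h2.2]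
  rcases hσ with ⟨rfl, h⟩ | ⟨rfl, h⟩ | rfl
  · have hcard := ncard_sdiff_singleton_lt_of_mem h hA
    have := ih (n - 1) (by omega) (hA.subset (sdiff_subset (t := {b q - q}))) hB hC hr.2 hbr
      (fun s hs => (hmem' s hs).imp_left fun hs' => ⟨hs', fun he => hoff (by norm_num) s hs (by
        have he : b s - s = b q - q := he
        linarith)⟩) (by omega)
    exact ((this.cons hr.1 (by simp) hlin').cons hq.1 (by simp) hlin).mono (by omega)
  · have hcard := ncard_sdiff_singleton_lt_of_mem h hB
    have := ih (n - 1) (by omega) hA (hB.subset (sdiff_subset (t := {b q + q}))) hC hr.2 hbr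
      (fun s hs => (hmem' s hs).imp_right fun hs' => hs'.imp_left fun hs' =>
        ⟨hs', fun he => hoff (by norm_num) s hs (by
          have he : b s + s = b q + q := he
          linarith)⟩) (by omega)
    exact ((this.cons hr.1 (by simp) hlin').cons hq.1 (by simp) hlin).mono (by omega)
  -- Slope `0` at `q` would prolong the flat stretch that was chosen maximal.
  · exact (hmax hqc hev).elim

end Lines

/-! ### Birth times are peak values -/

section Persistence

variable {E : Type*} [TopologicalSpace E] {X : Set E} {f : E → ℝ} {K : Set ℝ} {b : ℝ}

/-- The hypothesis `hK` says that `K` misses `[b - ε, b + ε)`. A component that contains a point of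
height at least `b - ε` also contains a peak above it, which the gap pushes up to `b + ε`. So the
two sets of components coincide. -/
theorem persistentRank_eq_of_forall_exists_peak
    (hpeak : ∀ x ∈ X, ∃ y ∈ X, f y ∈ K ∧ f x ≤ f y ∧
      y ∈ connectedComponentIn {z ∈ X | f x ≤ f z} x)
    {ε β : ℝ} (hε : 0 < ε) (hK : ∀ k ∈ K, b - ε ≤ k → b + ε ≤ k) (hβ : β ≤ b - ε) :
    persistentRank X f (b - ε) β = persistentRank X f (b + ε) β := by
  unfold persistentRank
  congr 1
  ext S
  constructor
  · rintro ⟨x, hx, hfx, rfl⟩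
    obtain ⟨y, hy, hyK, hxy, hcc⟩ := hpeak x hx
    refine ⟨y, hy, hK _ hyK (hfx.trans hxy), ?_⟩
    have hsub : {z ∈ X | f x ≤ f z} ⊆ {z ∈ X | β ≤ f z} :=
      fun z hz => ⟨hz.1, (hβ.trans hfx).trans hz.2⟩
    exact connectedComponentIn_eq (connectedComponentIn_mono x hsub hcc)
  · rintro ⟨x, hx, hfx, rfl⟩
    exact ⟨x, hx, by linarith, rfl⟩

theorem IsPersistencePoint.birth_mem {d : EReal} (h : IsPersistencePoint X f b d)
    (hKc : IsClosed K)
    (hpeak : ∀ x ∈ X, ∃ y ∈ X, f y ∈ K ∧ f x ≤ f y ∧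
      y ∈ connectedComponentIn {z ∈ X | f x ≤ f z} x) : b ∈ K := by
  by_contra hbK
  obtain ⟨η, hη, hball⟩ := Metric.isOpen_iff.1 hKc.isOpen_compl b hbK
  have hK : ∀ ε < η, ∀ k ∈ K, b - ε ≤ k → b + ε ≤ k := by
    intro ε hε k hk hle
    by_contra hlt
    refine hball (a := k) ?_ hk
    rw [Metric.mem_ball, Real.dist_eq, abs_lt]
    constructor <;> linarith
  rcases h with ⟨d', -, hd', hev⟩ | ⟨-, hev⟩
  -- The second bound ensures `d' + ε ≤ b - ε`, as the rank comparison requires.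
  · have hpos : 0 < min η ((b - d') / 2) := lt_min hη (by linarith)
    obtain ⟨ε, hε, hεm⟩ := (hev.and (Ioo_mem_nhdsGT hpos)).exists
    have h1 : ε < η := hεm.2.trans_le (min_le_left _ _)
    have h2 : ε < (b - d') / 2 := hεm.2.trans_le (min_le_right _ _)
    rw [persistentRank_eq_of_forall_exists_peak hpeak hεm.1 (hK ε h1) (by linarith),
      persistentRank_eq_of_forall_exists_peak hpeak hεm.1 (hK ε h1)
        (β := d' - ε) (by linarith [hεm.1])] at hε
    simp at hε
  · obtain ⟨ε, hε, hεm⟩ := (hev.and (Ioo_mem_nhdsGT hη)).exists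
    obtain ⟨β, hβ, hβle⟩ := (hε.and (eventually_le_atBot (b - ε))).exists
    rw [persistentRank_eq_of_forall_exists_peak hpeak hεm.1 (hK ε hεm.2) hβle] at hβ
    exact lt_irrefl _ hβ

end Persistence

/-! ### Distances in a metric graph -/

section Geodesic

variable {V : Type*} {G : SimpleGraph V} {ℓ : Sym2 V → ℝ}

theorem edgePoint_zero (u v : V) : edgePoint ℓ u v 0 = node u := by
  simp [edgePoint]

theorem edgePoint_length {u v : V} (h : ℓ s(u, v) ≠ 0) :
    edgePoint ℓ u v (ℓ s(u, v)) = node v := by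
  simp [edgePoint, h]

theorem edgePoint_swap {u v : V} (h : ℓ s(u, v) ≠ 0) (t : ℝ) :
    edgePoint ℓ v u t = edgePoint ℓ u v (ℓ s(u, v) - t) := by
  unfold edgePoint
  rw [Sym2.eq_swap (a := v), sub_div, div_self h, sub_sub_cancel, add_comm]

theorem edgePoint_apply_left {u v : V} (huv : u ≠ v) (t : ℝ) :
    edgePoint ℓ u v t u = 1 - t / ℓ s(u, v) := by
  simp [edgePoint, node, huv]

theorem edgePoint_apply_right {u v : V} (huv : u ≠ v) (t : ℝ) :
    edgePoint ℓ u v t v = t / ℓ s(u, v) := by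
  simp [edgePoint, node, huv.symm]

theorem edgePoint_apply_of_ne {u v w : V} (hu : w ≠ u) (hv : w ≠ v) (t : ℝ) :
    edgePoint ℓ u v t w = 0 := by
  simp [edgePoint, node, hu, hv]

theorem edgePoint_injective {u v : V} (huv : u ≠ v) (h : ℓ s(u, v) ≠ 0) :
    Function.Injective (edgePoint ℓ u v) := by
  intro t t' htt
  have := congrFun htt v
  rw [edgePoint_apply_right huv, edgePoint_apply_right huv] at this
  exact (div_left_inj' h).1 this

/-- A point in the interior of an edge lies on no other edge. -/
theorem edgePoint_eq_cases {w z w' z' : V} {t t' : ℝ} (hwz : w ≠ z) (hℓ : 0 < ℓ s(w, z))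
    (ht : t ∈ Icc 0 (ℓ s(w, z))) (h : edgePoint ℓ w z t = edgePoint ℓ w' z' t') :
    (w = w' ∧ z = z') ∨ (w = z' ∧ z = w') ∨ t = 0 ∨ t = ℓ s(w, z) := by
  rcases ht.1.eq_or_lt with h0 | h0
  · exact Or.inr (Or.inr (Or.inl h0.symm))
  rcases ht.2.eq_or_lt with h1 | h1
  · exact Or.inr (Or.inr (Or.inr h1))
  have hw : w = w' ∨ w = z' := by
    by_contra! hne
    have := congrFun h w
    rw [edgePoint_apply_left hwz, edgePoint_apply_of_ne hne.1 hne.2, sub_eq_zero, eq_comm,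
      div_eq_one_iff_eq hℓ.ne'] at this
    exact h1.ne this
  have hz : z = w' ∨ z = z' := by
    by_contra! hne
    have := congrFun h z
    rw [edgePoint_apply_right hwz, edgePoint_apply_of_ne hne.1 hne.2] at this
    exact (div_pos h0 hℓ).ne' this
  rcases hw with rfl | rfl <;> rcases hz with rfl | rfl
  · exact (hwz rfl).elim
  · exact Or.inl ⟨rfl, rfl⟩
  · exact Or.inr (Or.inl ⟨rfl, rfl⟩)
  · exact (hwz rfl).elim

/-! ### Paths and the shortest path metric -/

theorem PathLength.nonneg {x y : V → ℝ} {r : ℝ} (h : PathLength G ℓ x y r) : 0 ≤ r := by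
  induction h with
  | refl => exact le_rfl
  | move _ _ _ _ _ _ _ _ _ _ ih => positivity

theorem PathLength.trans {x y z : V → ℝ} {r r' : ℝ} (h : PathLength G ℓ x y r)
    (h' : PathLength G ℓ y z r') : PathLength G ℓ x z (r + r') := by
  induction h with
  | refl => simpa using h'
  | move u v t t' y r huv ht ht' _ ih =>
    rw [add_assoc]
    exact .move u v t t' z _ huv ht ht' (ih h')

theorem PathLength.symm {x y : V → ℝ} {r : ℝ} (h : PathLength G ℓ x y r) :
    PathLength G ℓ y x r := by
  induction h with
  | refl => exact .refl _
  | move u v t t' y r huv ht ht' _ ih =>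
    have := ih.trans (.move u v t' t _ 0 huv ht' ht (.refl _))
    rwa [add_zero, abs_sub_comm, add_comm] at this

theorem geodist_comm (x y : V → ℝ) : geodist G ℓ x y = geodist G ℓ y x := by
  unfold geodist
  congr 1
  ext r
  exact ⟨PathLength.symm, PathLength.symm⟩

theorem geodist_nonneg (x y : V → ℝ) : 0 ≤ geodist G ℓ x y :=
  Real.sInf_nonneg fun _ h => PathLength.nonneg h

theorem PathLength.geodist_le {x y : V → ℝ} {r : ℝ} (h : PathLength G ℓ x y r) :
    geodist G ℓ x y ≤ r :=
  csInf_le ⟨0, fun _ h => PathLength.nonneg h⟩ h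

theorem geodist_self (x : V → ℝ) : geodist G ℓ x x = 0 :=
  le_antisymm (PathLength.refl x).geodist_le (geodist_nonneg x x)

/-- The existence of a path is assumed because `sInf ∅ = 0` in `ℝ` would make the right-hand side
too small. -/
theorem geodist_edgePoint_le {u v : V} {t t' : ℝ} {q : V → ℝ} (huv : G.Adj u v)
    (ht : t ∈ Icc 0 (ℓ s(u, v))) (ht' : t' ∈ Icc 0 (ℓ s(u, v)))
    (hq : ∃ r, PathLength G ℓ (edgePoint ℓ u v t') q r) :
    geodist G ℓ (edgePoint ℓ u v t) q ≤ |t' - t| + geodist G ℓ (edgePoint ℓ u v t') q := by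
  rw [← sub_le_iff_le_add']
  exact le_csInf hq fun r hr =>
    sub_le_iff_le_add'.2 (PathLength.move u v t t' q r huv ht ht' hr).geodist_le

theorem exists_pathLength_node (hℓ : ∀ e ∈ G.edgeSet, 0 < ℓ e) (hG : G.Connected) (w w' : V) :
    ∃ r, PathLength G ℓ (node w) (node w') r := by
  obtain ⟨p⟩ := hG.preconnected w w'
  induction p with
  | nil => exact ⟨0, .refl _⟩
  | @cons x y _ h _ ih =>
    obtain ⟨r, hr⟩ := ih
    have hpos : 0 < ℓ s(x, y) := hℓ _ h
    rw [← edgePoint_length hpos.ne'] at hr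
    have := PathLength.move x y 0 _ _ r h ⟨le_rfl, hpos.le⟩ ⟨hpos.le, le_rfl⟩ hr
    rw [edgePoint_zero] at this
    exact ⟨_, this⟩

theorem exists_pathLength_edgePoint_node (hℓ : ∀ e ∈ G.edgeSet, 0 < ℓ e) (hG : G.Connected)
    {w z : V} (h : G.Adj w z) {t : ℝ} (ht : t ∈ Icc 0 (ℓ s(w, z))) (w' : V) :
    ∃ r, PathLength G ℓ (edgePoint ℓ w z t) (node w') r := by
  obtain ⟨r, hr⟩ := exists_pathLength_node hℓ hG w w'
  rw [← edgePoint_zero (ℓ := ℓ) w z] at hr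
  exact ⟨_, .move w z t 0 _ r h ht ⟨le_rfl, (hℓ _ h).le⟩ hr⟩

/-- A path that starts on the edge `wz` leaves it through `w` or through `z`, or stays in it. -/
theorem PathLength.le_cases (hℓ : ∀ e ∈ G.edgeSet, 0 < ℓ e) {x q : V → ℝ} {r : ℝ}
    (h : PathLength G ℓ x q r) : ∀ {w z : V} {t : ℝ}, G.Adj w z → t ∈ Icc 0 (ℓ s(w, z)) →
      x = edgePoint ℓ w z t →
      t + geodist G ℓ (node w) q ≤ r ∨ ℓ s(w, z) - t + geodist G ℓ (node z) q ≤ r ∨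
        ∃ t' ∈ Icc 0 (ℓ s(w, z)), q = edgePoint ℓ w z t' ∧ |t' - t| ≤ r := by
  induction h with
  | refl x => exact fun {w z t} _ ht hx => Or.inr (Or.inr ⟨t, ht, hx, by simp⟩)
  | move w' z' t₁ t₂ q r hadj ht₁ ht₂ hpath ih =>
    intro w z t hwz ht hx
    have hpos : 0 < ℓ s(w, z) := hℓ _ hwz
    have hle := (PathLength.move w' z' t₁ t₂ q r hadj ht₁ ht₂ hpath).geodist_le
    have hadd : ∀ a : ℝ, |a - t| ≤ |a - t₂| + |t₂ - t| := fun a => abs_sub_le a t₂ t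
    -- The first move either stays in `wz`, in one of its two orientations, or starts at an end of
    -- `wz`, where the bound by the distance from that node is immediate.
    rcases edgePoint_eq_cases hwz.ne hpos ht hx.symm with ⟨rfl, rfl⟩ | ⟨rfl, rfl⟩ | rfl | rfl
    · obtain rfl := edgePoint_injective hwz.ne hpos.ne' hx
      rcases ih hwz ht₂ rfl with h | h | ⟨a, ha, hqa, har⟩
      · exact Or.inl (by linarith [neg_abs_le (t₂ - t₁)])
      · exact Or.inr (Or.inl (by linarith [le_abs_self (t₂ - t₁)]))
      · exact Or.inr (Or.inr ⟨a, ha, hqa, by linarith [hadd a]⟩)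
    · rw [edgePoint_swap hpos.ne'] at hx
      have ht₁t := edgePoint_injective hwz.ne hpos.ne' hx
      rw [Sym2.eq_swap (a := z)] at ht₂
      have ht₂' : ℓ s(w, z) - t₂ ∈ Icc 0 (ℓ s(w, z)) :=
        ⟨by linarith [ht₂.2], by linarith [ht₂.1]⟩
      rcases ih hwz ht₂' (edgePoint_swap hpos.ne' t₂) with h | h | ⟨a, ha, hqa, har⟩
      · exact Or.inl (by linarith [le_abs_self (t₂ - t₁)])
      · exact Or.inr (Or.inl (by linarith [neg_abs_le (t₂ - t₁)]))
      · refine Or.inr (Or.inr ⟨a, ha, hqa, ?_⟩)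
        have := abs_sub_le a (ℓ s(w, z) - t₂) t
        have h2 : ℓ s(w, z) - t₂ - t = -(t₂ - t₁) := by linarith
        rw [h2, abs_neg] at this
        linarith
    · rw [hx, edgePoint_zero] at hle
      exact Or.inl (by linarith)
    · rw [hx, edgePoint_length hpos.ne'] at hle
      exact Or.inr (Or.inl (by linarith))

theorem geodist_edgePoint_le_min (hℓ : ∀ e ∈ G.edgeSet, 0 < ℓ e) {w z : V} {t : ℝ} {q : V → ℝ}
    (h : G.Adj w z) (ht : t ∈ Icc 0 (ℓ s(w, z)))
    (hw : ∃ r, PathLength G ℓ (node w) q r) (hz : ∃ r, PathLength G ℓ (node z) q r) :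
    geodist G ℓ (edgePoint ℓ w z t) q ≤
      min (t + geodist G ℓ (node w) q) (ℓ s(w, z) - t + geodist G ℓ (node z) q) := by
  have hpos : 0 < ℓ s(w, z) := hℓ _ h
  refine le_min ?_ ?_
  · rw [← edgePoint_zero (ℓ := ℓ) w z] at hw ⊢
    have := geodist_edgePoint_le h ht ⟨le_rfl, hpos.le⟩ hw
    rwa [zero_sub, abs_neg, abs_of_nonneg ht.1] at this
  · rw [← edgePoint_length hpos.ne'] at hz ⊢
    have := geodist_edgePoint_le h ht ⟨hpos.le, le_rfl⟩ hz
    rwa [abs_of_nonneg (sub_nonneg.2 ht.2)] at this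

/-- The distance to a point outside the interior of an edge, along that edge. -/
theorem geodist_edgePoint_eq_min (hℓ : ∀ e ∈ G.edgeSet, 0 < ℓ e) {w z : V} {t : ℝ} {q : V → ℝ}
    (h : G.Adj w z) (ht : t ∈ Icc 0 (ℓ s(w, z)))
    (hw : ∃ r, PathLength G ℓ (node w) q r) (hz : ∃ r, PathLength G ℓ (node z) q r)
    (hq : ∀ t' ∈ Icc 0 (ℓ s(w, z)), q = edgePoint ℓ w z t' → q = node w ∨ q = node z) :
    geodist G ℓ (edgePoint ℓ w z t) q =
      min (t + geodist G ℓ (node w) q) (ℓ s(w, z) - t + geodist G ℓ (node z) q) := by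
  have hpos : 0 < ℓ s(w, z) := hℓ _ h
  refine le_antisymm (geodist_edgePoint_le_min hℓ h ht hw hz) ?_
  have hne : ∃ r, PathLength G ℓ (edgePoint ℓ w z t) q r := by
    obtain ⟨r, hr⟩ := hw
    rw [← edgePoint_zero (ℓ := ℓ) w z] at hr
    exact ⟨_, .move w z t 0 _ r h ht ⟨le_rfl, hpos.le⟩ hr⟩
  refine le_csInf hne fun r hr => ?_
  rcases PathLength.le_cases hℓ hr h ht rfl with h' | h' | ⟨t', ht', hqt, hr'⟩
  · exact (min_le_left _ _).trans h'
  · exact (min_le_right _ _).trans h'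
  · rcases hq t' ht' hqt with hq' | hq'
    · refine (min_le_left _ _).trans ?_
      have : t' = 0 := edgePoint_injective h.ne hpos.ne'
        (hqt.symm.trans (hq'.trans (edgePoint_zero w z).symm))
      rw [hq', geodist_self]
      rw [this, zero_sub, abs_neg] at hr'
      linarith [le_abs_self t]
    · refine (min_le_right _ _).trans ?_
      have : t' = ℓ s(w, z) := edgePoint_injective h.ne hpos.ne'
        (hqt.symm.trans (hq'.trans (edgePoint_length hpos.ne').symm))
      rw [hq', geodist_self]
      rw [this] at hr'
      linarith [le_abs_self (ℓ s(w, z) - t)]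

/-- The direct segment competes with detours through both ends: an edge may be longer than the
distance between its endpoints. -/
theorem geodist_edgePoint_edgePoint (hℓ : ∀ e ∈ G.edgeSet, 0 < ℓ e) (hG : G.Connected) {u v : V}
    {s t : ℝ} (h : G.Adj u v) (hs : s ∈ Icc 0 (ℓ s(u, v))) (ht : t ∈ Icc 0 (ℓ s(u, v))) :
    geodist G ℓ (edgePoint ℓ u v t) (edgePoint ℓ u v s) =
      min |s - t| (min (t + geodist G ℓ (node u) (edgePoint ℓ u v s))
        (ℓ s(u, v) - t + geodist G ℓ (node v) (edgePoint ℓ u v s))) := by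
  have hpos : 0 < ℓ s(u, v) := hℓ _ h
  have hnode : ∀ w, ∃ r, PathLength G ℓ (node w) (edgePoint ℓ u v s) r := fun w =>
    (exists_pathLength_edgePoint_node hℓ hG h hs w).imp fun _ => PathLength.symm
  have hmove : PathLength G ℓ (edgePoint ℓ u v t) (edgePoint ℓ u v s) |s - t| := by
    simpa using PathLength.move u v t s _ 0 h ht hs (.refl _)
  refine le_antisymm (le_min hmove.geodist_le
    (geodist_edgePoint_le_min hℓ h ht (hnode u) (hnode v))) (le_csInf ⟨_, hmove⟩ fun r hr => ?_)
  rcases PathLength.le_cases hℓ hr h ht rfl with h' | h' | ⟨t', ht', hqt, hr'⟩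
  · exact ((min_le_right _ _).trans (min_le_left _ _)).trans h'
  · exact ((min_le_right _ _).trans (min_le_right _ _)).trans h'
  · obtain rfl := edgePoint_injective h.ne hpos.ne' hqt
    exact (min_le_left _ _).trans hr'

/-- The distance from a moving basepoint on the edge `uv` to a fixed node. -/
theorem geodist_node_edgePoint (hℓ : ∀ e ∈ G.edgeSet, 0 < ℓ e) (hG : G.Connected) {u v : V}
    {s : ℝ} (h : G.Adj u v) (hs : s ∈ Icc 0 (ℓ s(u, v))) (w : V) :
    geodist G ℓ (node w) (edgePoint ℓ u v s) = min (s + geodist G ℓ (node u) (node w))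
      (ℓ s(u, v) - s + geodist G ℓ (node v) (node w)) := by
  have hpos : 0 < ℓ s(u, v) := hℓ _ h
  rw [geodist_comm]
  refine geodist_edgePoint_eq_min hℓ h hs (exists_pathLength_node hℓ hG u w)
    (exists_pathLength_node hℓ hG v w) fun t' ht' hq => ?_
  by_contra! hne
  have hwu : w ≠ u := fun e => hne.1 (by rw [e])
  have hwv : w ≠ v := fun e => hne.2 (by rw [e])
  have := congrFun hq w
  rw [edgePoint_apply_of_ne hwu hwv] at this
  simp [node] at this

/-! ### Peaks of the distance function -/

theorem continuous_edgePoint (u v : V) : Continuous (edgePoint ℓ u v) := by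
  unfold edgePoint
  fun_prop

theorem edgePoint_mem_segment {u v : V} {t : ℝ} (ht : t ∈ Icc 0 (ℓ s(u, v))) :
    edgePoint ℓ u v t ∈ segment ℝ (node u : V → ℝ) (node v) := by
  have hL : 0 ≤ ℓ s(u, v) := ht.1.trans ht.2
  exact ⟨1 - t / ℓ s(u, v), t / ℓ s(u, v), sub_nonneg.2 (div_le_one_of_le₀ ht.2 hL),
    div_nonneg ht.1 hL, by ring, rfl⟩

theorem edgePoint_mem_realization {u v : V} (h : G.Adj u v) {t : ℝ}
    (ht : t ∈ Icc 0 (ℓ s(u, v))) : edgePoint ℓ u v t ∈ realization G :=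
  Or.inr ⟨u, v, h, edgePoint_mem_segment ht⟩

theorem exists_eq_edgePoint (hℓ : ∀ e ∈ G.edgeSet, 0 < ℓ e) (hG : G.Connected) {u v : V}
    (huv : G.Adj u v) {x : V → ℝ} (hx : x ∈ realization G) :
    ∃ w z t, G.Adj w z ∧ t ∈ Icc 0 (ℓ s(w, z)) ∧ x = edgePoint ℓ w z t := by
  rcases hx with ⟨w, rfl⟩ | ⟨w, z, hwz, α, β, hα, hβ, hαβ, rfl⟩
  -- The edge `uv` and connectedness rule out isolated nodes, so every node is an end of some edge.
  · have : Nontrivial V := ⟨u, v, huv.ne⟩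
    obtain ⟨z, hz⟩ := hG.preconnected.exists_adj_of_nontrivial w
    exact ⟨w, z, 0, hz, ⟨le_rfl, (hℓ _ hz).le⟩, (edgePoint_zero w z).symm⟩
  · have hpos : 0 < ℓ s(w, z) := hℓ _ hwz
    refine ⟨w, z, β * ℓ s(w, z), hwz, ⟨by positivity, ?_⟩, ?_⟩
    · nlinarith
    · rw [edgePoint, mul_div_cancel_right₀ _ hpos.ne', ← hαβ, add_sub_cancel_right]

/-- If the function is `min (α + t) (β - t)` along a part of an edge that contains the peak
`t = (β - α) / 2`, then each point of that part can climb to the peak. -/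
theorem exists_peak_of_eq_min {f : (V → ℝ) → ℝ} {w z : V} (hwz : G.Adj w z) {I : Set ℝ}
    (hI : I.OrdConnected) (hIsub : I ⊆ Icc 0 (ℓ s(w, z))) {α β t : ℝ} (ht : t ∈ I)
    (hpk : (β - α) / 2 ∈ I)
    (hf : ∀ τ ∈ I, f (edgePoint ℓ w z τ) = min (α + τ) (β - τ)) :
    ∃ y ∈ realization G, f y = (α + β) / 2 ∧ f (edgePoint ℓ w z t) ≤ f y ∧
      y ∈ connectedComponentIn
        {p ∈ realization G | f (edgePoint ℓ w z t) ≤ f p} (edgePoint ℓ w z t) := by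
  have hsub : uIcc t ((β - α) / 2) ⊆ I := hI.uIcc_subset ht hpk
  have hclimb : ∀ τ ∈ uIcc t ((β - α) / 2), f (edgePoint ℓ w z t) ≤ f (edgePoint ℓ w z τ) := by
    intro τ hτ
    rw [hf t ht, hf τ (hsub hτ)]
    -- Left of the peak the height at `t` is at most `α + t`, right of it at most `β - t`; these
    -- bounds persist up to the peak.
    rcases mem_uIcc.1 hτ with ⟨h1, h2⟩ | ⟨h1, h2⟩
    · exact (min_le_left _ _).trans (le_min (by linarith) (by linarith))
    · exact (min_le_right _ _).trans (le_min (by linarith) (by linarith))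
  refine ⟨edgePoint ℓ w z ((β - α) / 2), edgePoint_mem_realization hwz (hIsub hpk), ?_,
    hclimb _ right_mem_uIcc, ?_⟩
  · rw [hf _ hpk, show α + (β - α) / 2 = (α + β) / 2 by ring,
      show β - (β - α) / 2 = (α + β) / 2 by ring, min_self]
  · have hpre : IsPreconnected (edgePoint ℓ w z '' uIcc t ((β - α) / 2)) :=
      isPreconnected_uIcc.image _ (continuous_edgePoint w z).continuousOn
    refine hpre.subset_connectedComponentIn (mem_image_of_mem _ left_mem_uIcc) ?_
      (mem_image_of_mem _ right_mem_uIcc)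
    rintro _ ⟨τ, hτ, rfl⟩
    exact ⟨edgePoint_mem_realization hwz (hIsub (hsub hτ)), hclimb τ hτ⟩

/-- The peak value of the distance to the node `o` on an edge. -/
noncomputable def peakValue (G : SimpleGraph V) (ℓ : Sym2 V → ℝ) (o : V) : Sym2 V → ℝ :=
  fun e => Sym2.lift ⟨fun w z => (geodist G ℓ (node o) (node w) + geodist G ℓ (node o) (node z)
    + ℓ s(w, z)) / 2, fun w z => by
      simp only [Sym2.eq_swap (a := w), add_comm (geodist G ℓ _ (node w))]⟩ e

theorem peakValue_mk (o w z : V) : peakValue G ℓ o s(w, z) = (geodist G ℓ (node o) (node w) +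
    geodist G ℓ (node o) (node z) + ℓ s(w, z)) / 2 := rfl

/-- Intercepts of the peak values that grow with slope `1` as the basepoint moves away from
`u`. -/
def risingIntercepts (G : SimpleGraph V) (ℓ : Sym2 V → ℝ) (u : V) : Set ℝ :=
  insert 0 (peakValue G ℓ u '' G.edgeSet)

/-- Intercepts of the peak values that fall with slope `-1` as the basepoint on `uv` moves
towards `v`. -/
def fallingIntercepts (G : SimpleGraph V) (ℓ : Sym2 V → ℝ) (u v : V) : Set ℝ :=
  insert (ℓ s(u, v)) ((fun e => ℓ s(u, v) + peakValue G ℓ v e) '' G.edgeSet)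

/-- Peak values that do not depend on the position of the basepoint on the edge `uv`. -/
def constantPeaks (G : SimpleGraph V) (ℓ : Sym2 V → ℝ) (u v : V) : Set ℝ :=
  insert ((ℓ s(u, v) + geodist G ℓ (node u) (node v)) / 2)
    (range fun e : V × V => (geodist G ℓ (node u) (node e.1) + geodist G ℓ (node v) (node e.2) +
      ℓ s(u, v) + ℓ s(e.1, e.2)) / 2)

/-- The peak values of the distance to the point at arclength `s` on the edge `uv`. -/
def peakValues (G : SimpleGraph V) (ℓ : Sym2 V → ℝ) (u v : V) (s : ℝ) : Set ℝ :=
  {k | k - s ∈ risingIntercepts G ℓ u ∨ k + s ∈ fallingIntercepts G ℓ u v ∨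
    k ∈ constantPeaks G ℓ u v}

/-- The basepoint cuts its edge into two parts, and each is treated as an edge with one peak. If the
shortest way from the basepoint to `u` is along the edge, the left peak is `u` itself, at height
`s`; this is the extra intercept `0`, and symmetrically `v` gives `ℓ s(u, v)`. Otherwise the peak is
the one of the cycle through `uv`, whose height is constant. -/
theorem exists_peak_same_edge (hℓ : ∀ e ∈ G.edgeSet, 0 < ℓ e) (hG : G.Connected) {u v : V}
    (huv : G.Adj u v) {s t : ℝ} (hs : s ∈ Icc 0 (ℓ s(u, v))) (ht : t ∈ Icc 0 (ℓ s(u, v))) :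
    ∃ y ∈ realization G, geodist G ℓ (edgePoint ℓ u v s) y ∈ peakValues G ℓ u v s ∧
      geodist G ℓ (edgePoint ℓ u v s) (edgePoint ℓ u v t) ≤ geodist G ℓ (edgePoint ℓ u v s) y ∧
      y ∈ connectedComponentIn {p ∈ realization G |
        geodist G ℓ (edgePoint ℓ u v s) (edgePoint ℓ u v t) ≤ geodist G ℓ (edgePoint ℓ u v s) p}
        (edgePoint ℓ u v t) := by
  have hdist := fun τ hτ => (geodist_comm _ _).trans
    (geodist_edgePoint_edgePoint hℓ hG (s := s) (t := τ) huv hs hτ)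
  have hu := geodist_node_edgePoint hℓ hG huv hs u
  have hv := geodist_node_edgePoint hℓ hG huv hs v
  rw [geodist_self, add_zero] at hu hv
  have hu0 := geodist_nonneg (G := G) (ℓ := ℓ) (node u) (edgePoint ℓ u v s)
  have hv0 := geodist_nonneg (G := G) (ℓ := ℓ) (node v) (edgePoint ℓ u v s)
  have hus : geodist G ℓ (node u) (edgePoint ℓ u v s) ≤ s := hu ▸ min_le_left _ _
  have hvs : geodist G ℓ (node v) (edgePoint ℓ u v s) ≤ ℓ s(u, v) - s := hv ▸ min_le_right _ _
  rcases le_total t s with hts | hts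
  · obtain ⟨y, hy, hfy, hle, hcc⟩ := exists_peak_of_eq_min (G := G) (ℓ := ℓ)
      (f := geodist G ℓ (edgePoint ℓ u v s)) huv (ordConnected_Icc (a := 0) (b := s))
      (Icc_subset_Icc_right hs.2) (α := geodist G ℓ (node u) (edgePoint ℓ u v s)) (β := s)
      (t := t) ⟨ht.1, hts⟩ ⟨by linarith, by linarith⟩ (fun τ hτ => by
        rw [hdist τ ⟨hτ.1, hτ.2.trans hs.2⟩, abs_of_nonneg (sub_nonneg.2 hτ.2), ← min_assoc,
          min_eq_left ((min_le_left _ _).trans (by linarith [hs.2])), min_comm,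
          add_comm τ])
    refine ⟨y, hy, ?_, hle, hcc⟩
    rw [hfy, hu]
    rcases min_choice s (ℓ s(u, v) - s + geodist G ℓ (node v) (node u)) with h | h
    · rw [h]
      exact Or.inl (Or.inl (by ring))
    · rw [h]
      exact Or.inr (Or.inr (Or.inl (by rw [geodist_comm (node v)]; ring)))
  · obtain ⟨y, hy, hfy, hle, hcc⟩ := exists_peak_of_eq_min (G := G) (ℓ := ℓ)
      (f := geodist G ℓ (edgePoint ℓ u v s)) huv (ordConnected_Icc (a := s) (b := ℓ s(u, v)))
      (Icc_subset_Icc_left hs.1) (α := -s)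
      (β := geodist G ℓ (node v) (edgePoint ℓ u v s) + ℓ s(u, v))
      (t := t) ⟨hts, ht.2⟩ ⟨by linarith [hs.2], by linarith⟩ (fun τ hτ => by
        rw [hdist τ ⟨hs.1.trans hτ.1, hτ.2⟩, abs_sub_comm, abs_of_nonneg (sub_nonneg.2 hτ.1),
          ← min_assoc, min_eq_left (a := τ - s) (by linarith [hs.1])]
        congr 1 <;> ring)
    refine ⟨y, hy, ?_, hle, hcc⟩
    rw [hfy, hv]
    rcases min_choice (s + geodist G ℓ (node u) (node v)) (ℓ s(u, v) - s) with h | h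
    · rw [h]
      exact Or.inr (Or.inr (Or.inl (by ring)))
    · rw [h]
      exact Or.inr (Or.inl (Or.inl (by ring)))

theorem exists_peak_other_edge (hℓ : ∀ e ∈ G.edgeSet, 0 < ℓ e) (hG : G.Connected) {u v w z : V}
    (huv : G.Adj u v) (hwz : G.Adj w z) (hne : s(w, z) ≠ s(u, v)) {s t : ℝ}
    (hs : s ∈ Icc 0 (ℓ s(u, v))) (ht : t ∈ Icc 0 (ℓ s(w, z))) :
    ∃ y ∈ realization G, geodist G ℓ (edgePoint ℓ u v s) y ∈ peakValues G ℓ u v s ∧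
      geodist G ℓ (edgePoint ℓ u v s) (edgePoint ℓ w z t) ≤ geodist G ℓ (edgePoint ℓ u v s) y ∧
      y ∈ connectedComponentIn {p ∈ realization G |
        geodist G ℓ (edgePoint ℓ u v s) (edgePoint ℓ w z t) ≤ geodist G ℓ (edgePoint ℓ u v s) p}
        (edgePoint ℓ w z t) := by
  have hpos : 0 < ℓ s(w, z) := hℓ _ hwz
  have hnode : ∀ x, ∃ r, PathLength G ℓ (node x) (edgePoint ℓ u v s) r := fun x =>
    (exists_pathLength_edgePoint_node hℓ hG huv hs x).imp fun _ => PathLength.symm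
  have hdist := fun τ hτ => (geodist_comm _ _).trans
    (geodist_edgePoint_eq_min hℓ (t := τ) (q := edgePoint ℓ u v s) hwz hτ (hnode w) (hnode z)
      (fun t' ht' hq => by
        rcases edgePoint_eq_cases hwz.ne hpos ht' hq.symm with ⟨rfl, rfl⟩ | ⟨rfl, rfl⟩ | rfl | rfl
        · exact (hne rfl).elim
        · exact (hne Sym2.eq_swap).elim
        · exact Or.inl (hq.trans (edgePoint_zero w z))
        · exact Or.inr (hq.trans (edgePoint_length hpos.ne'))))
  have h0 := hdist 0 ⟨le_rfl, hpos.le⟩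
  have h1 := hdist (ℓ s(w, z)) ⟨hpos.le, le_rfl⟩
  rw [edgePoint_zero, geodist_comm, zero_add, sub_zero] at h0
  rw [edgePoint_length hpos.ne', geodist_comm, sub_self, zero_add] at h1
  -- The distance formula at the two ends shows that the node distances differ by at most the edge
  -- length, which places the peak on the edge.
  have h0' := min_eq_left_iff.1 h0.symm
  have h1' := min_eq_right_iff.1 h1.symm
  obtain ⟨y, hy, hfy, hle, hcc⟩ := exists_peak_of_eq_min (G := G) (ℓ := ℓ)
    (f := geodist G ℓ (edgePoint ℓ u v s)) hwz (ordConnected_Icc (a := 0) (b := ℓ s(w, z)))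
    subset_rfl (α := geodist G ℓ (node w) (edgePoint ℓ u v s))
    (β := geodist G ℓ (node z) (edgePoint ℓ u v s) + ℓ s(w, z)) ht
    ⟨by linarith, by linarith⟩ (fun τ hτ => by
      rw [hdist τ hτ]
      congr 1 <;> ring)
  refine ⟨y, hy, ?_, hle, hcc⟩
  rw [hfy, geodist_node_edgePoint hℓ hG huv hs w, geodist_node_edgePoint hℓ hG huv hs z]
  rcases min_choice (s + geodist G ℓ (node u) (node w))
      (ℓ s(u, v) - s + geodist G ℓ (node v) (node w)) with hw | hw <;>
    rcases min_choice (s + geodist G ℓ (node u) (node z))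
      (ℓ s(u, v) - s + geodist G ℓ (node v) (node z)) with hz | hz <;> rw [hw, hz]
  · exact Or.inl (Or.inr ⟨s(w, z), hwz, by rw [peakValue_mk]; ring⟩)
  · exact Or.inr (Or.inr (Or.inr ⟨(w, z), by ring⟩))
  · exact Or.inr (Or.inr (Or.inr ⟨(z, w), by simp only [Sym2.eq_swap (a := z)]; ring⟩))
  · exact Or.inr (Or.inl (Or.inr ⟨s(w, z), hwz, by simp only [peakValue_mk]; ring⟩))

/-! ### Counting the lines that carry the peak values -/

variable [Finite V]

theorem finite_risingIntercepts (u : V) : (risingIntercepts G ℓ u).Finite :=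
  (G.edgeSet.toFinite.image _).insert _

theorem finite_fallingIntercepts (u v : V) : (fallingIntercepts G ℓ u v).Finite :=
  (G.edgeSet.toFinite.image _).insert _

/-- Finiteness suffices here. The set runs over all ordered pairs of nodes, and a bound through its
size would not be linear in `m`. -/
theorem finite_constantPeaks (u v : V) : (constantPeaks G ℓ u v).Finite :=
  (finite_range _).insert _

theorem ncard_risingIntercepts_le (u : V) :
    (risingIntercepts G ℓ u).ncard ≤ G.edgeSet.ncard + 1 :=
  (ncard_insert_le _ _).trans (Nat.succ_le_succ (ncard_image_le G.edgeSet.toFinite))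

theorem ncard_fallingIntercepts_le (u v : V) :
    (fallingIntercepts G ℓ u v).ncard ≤ G.edgeSet.ncard + 1 :=
  (ncard_insert_le _ _).trans (Nat.succ_le_succ (ncard_image_le G.edgeSet.toFinite))

theorem isClosed_peakValues (u v : V) (s : ℝ) : IsClosed (peakValues G ℓ u v s) :=
  ((finite_risingIntercepts u).isClosed.preimage (continuous_id.sub continuous_const)).union
    (((finite_fallingIntercepts u v).isClosed.preimage
      (continuous_id.add continuous_const)).union (finite_constantPeaks u v).isClosed)

/-- Birth times in the diagram of the distance to a point of the edge `uv` are peak values. -/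
theorem InDiagram.birth_mem_peakValues (hℓ : ∀ e ∈ G.edgeSet, 0 < ℓ e) (hG : G.Connected)
    {u v : V} (huv : G.Adj u v) {s : ℝ} (hs : s ∈ Icc 0 (ℓ s(u, v))) {b : ℝ} {d : EReal}
    (h : InDiagram G ℓ (edgePoint ℓ u v s) b d) : b ∈ peakValues G ℓ u v s := by
  refine IsPersistencePoint.birth_mem h (isClosed_peakValues u v s) fun x hx => ?_
  obtain ⟨w, z, t, hwz, ht, rfl⟩ := exists_eq_edgePoint hℓ hG huv hx
  by_cases hne : s(w, z) = s(u, v)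
  · rcases Sym2.eq_iff.1 hne with ⟨rfl, rfl⟩ | ⟨rfl, rfl⟩
    · exact exists_peak_same_edge hℓ hG huv hs ht
    · rw [hne] at ht
      rw [edgePoint_swap (hℓ _ huv).ne']
      exact exists_peak_same_edge hℓ hG huv hs ⟨by linarith [ht.2], by linarith [ht.1]⟩
  · exact exists_peak_other_edge hℓ hG huv hwz hne hs ht

end Geodesic

end MetricGraph

theorem mainTheorem10 :
    ∃ C : ℕ, ∀ (V : Type*) [Finite V] (G : SimpleGraph V), G.Connected →
      ∀ ℓ : Sym2 V → ℝ, (∀ e ∈ G.edgeSet, 0 < ℓ e) →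
      ∀ u v : V, G.Adj u v →
      ∀ (a c : ℝ), 0 ≤ a → a ≤ c → c ≤ ℓ s(u, v) →
      ∀ (b : ℝ → ℝ) (d : ℝ → EReal), MetricGraph.IsTracking G ℓ u v a c b d →
        MetricGraph.IsUnitPiecewiseLinearOn b a c (C * G.edgeSet.ncard) ∧
        LipschitzOnWith 1 b (Set.Icc a c) := by
  -- At most `2 * m + 2` sloped lines give at most `2 * (2 * m + 2) + 1 = 4 * m + 5` pieces, which
  -- is at most `9 * m` because `uv` is an edge and so `m ≥ 1`.
  refine ⟨9, fun V _ G hG ℓ hℓ u v huv a c ha hac hc b d hT => ?_⟩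
  have hmem : ∀ s ∈ Ioo a c, b s ∈ MetricGraph.peakValues G ℓ u v s := fun s hs =>
    (hT.mem_interior s hs).birth_mem_peakValues hℓ hG huv
      ⟨ha.trans hs.1.le, hs.2.le.trans hc⟩
  have hA := MetricGraph.finite_risingIntercepts (G := G) (ℓ := ℓ) u
  have hB := MetricGraph.finite_fallingIntercepts (G := G) (ℓ := ℓ) u v
  have hC := MetricGraph.finite_constantPeaks (G := G) (ℓ := ℓ) u v
  have hcA := MetricGraph.ncard_risingIntercepts_le (G := G) (ℓ := ℓ) u
  have hcB := MetricGraph.ncard_fallingIntercepts_le (G := G) (ℓ := ℓ) u v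
  have hm : 0 < G.edgeSet.ncard := (ncard_pos G.edgeSet.toFinite).2 ⟨s(u, v), huv⟩
  exact ⟨(MetricGraph.isUnitPiecewiseLinearOn_of_mem_lines _ hA hB hC hac
    hT.continuousOn_birth hmem le_rfl).mono (by omega),
    MetricGraph.lipschitzOnWith_of_mem_lines hA hB hC hT.continuousOn_birth hmem⟩
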